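/- Let $\mathbb R^\infty=\mathbb R^{\mathbb N}$ carry the product topology. Call $R=\prod_{i\in\mathbb N}R_i$ with Borel $R_i\subseteq\mathbb R$ an ordinary rectangle if $\mathrm{vol}(R):=\lim_{n}\prod_{i<n}|R_i|$ exists in $[0,\infty)$, where $|\cdot|$ is Lebesgue measure on $\mathbb R$ and $0\cdot\infty=0$. Let $\mu=\mu_{(1,1,\dots)}$ be the ordinary $(1,1,\dots)$-Lebesgue measure: the Borel measure obtained by restricting to Borel sets the outer measure $X\mapsto\inf\{\sum_j\mathrm{vol}(R^j): X\subseteq\bigcup_j R^j\}$ (countable covers by ordinary rectangles). It is translation invariant and satisfies $\mu(R)=\mathrm{vol}(R)$ for every ordinary rectangle $R$. For a real sequence $(\lambda_k)_{k\in\mathbb N}$ let $\Phi_t(a)=(e^{t\lambda_k}a_k)_{k\in\mathbb N}$, $t\in\mathbb R$, be the infinite generalised Malthusian flow. Let $n\ge1$, $t_1<\dots<t_n$ and $m_1,\dots,m_n>0$, and let $\tau$ be any choice operator: it assigns to every nonempty family of subsets of $\mathbb R^\infty$ a member of that family. Satisfaction rule: for an initial system $Y\subseteq\mathbb R^\infty$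 put $S_1=\Phi_{t_1}(Y)$. Consumer $k$ takes $C_k=\tau\{X\subseteq S_k: X \text{ Borel},\ \mu(X)=m_k\}$, and $S_{k+1}=\Phi_{t_{k+1}-t_k}(S_k\setminus C_k)$. The demands are satisfied by $Y$ if, for every $k\le n$, $C_k$ is a Borel subset of $S_k$ of measure $m_k$. A real number $m$ is a solution of the Satisfaction Problem of Consumers Demands (SPCD) if $m$ is the least element of the set of measures $\mu(Y)\in(0,\infty]$ of Borel sets $Y$ of positive measure by which the demands are satisfied. Then the following hold. (1) If $\sum_{k=0}^\infty\lambda_k$ converges (possibly conditionally) to a real number $L$, put $m=\sum_{k=1}^n m_k e^{-t_kL}$. Every Borel set $Y$ with $\mu(Y)=m$ satisfies the demands, and for such $Y$ the set $S_n$ offered to the last consumer has measure exactly $m_n$. Moreover $m$ is a solution of the SPCD. (2) If the flow is, in the sense of $\mu$, pressing, expansible or stable, then the SPCD has a solution. These mean respectively that, for all Borel $D$ with $0<\mu(D)<\infty$: $\mu(\Phi_{s}(D))>\mu(\Phi_{s'}(D))$ whenever $0<s<s'$; $\mu(\Phi_{s}(D))<\mu(\Phi_{s'}(D))$ whenever $0<s<s'$;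 $\mu(\Phi_s(D))=\mu(D)$ for all $s>0$. (3) If $t_1>0$ and the flow is, in the sense of $\mu$, totally pressing or totally expansible, then the SPCD has no solution. These mean respectively that, for all $s>0$ and all Borel $D$ with $0<\mu(D)<\infty$: $\mu(\Phi_s(D))=0$; $\mu(\Phi_s(D))=\infty$. -/

import Mathlib

open Filter Topology MeasureTheory Set
open scoped ENNReal

/-! ## The ordinary `(1,1,…)`-Lebesgue measure on `ℝ^∞ = ℕ → ℝ` -/

/-- `β` is the ordinary product of the numbers `b i ∈ [0, ∞]`: the limit of the partial products. -/
def IsOrdinaryProduct (b : ℕ → ℝ≥0∞) (β : ℝ≥0∞) : Prop :=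
  Tendsto (fun n => ∏ i ∈ Finset.range n, b i) atTop (𝓝 β)

/-- The infinite-dimensional measurable rectangle `∏ R i` has Borel sides and its ordinary product
of side lengths exists, is finite, and equals `β`. -/
structure IsOrdinaryRectangle (R : ℕ → Set ℝ) (β : ℝ≥0∞) : Prop where
  measurable : ∀ i, MeasurableSet (R i)
  finite : β ≠ ∞
  product : IsOrdinaryProduct (fun i => volume (R i)) β

/-- A translation-invariant Borel measure on `ℝ^∞` that gives every ordinary rectangle its
ordinary product as measure. -/
structure IsOrdinaryLebesgueMeasure (ν : Measure (ℕ → ℝ)) : Prop where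
  invariant : ∀ v : ℕ → ℝ, ν.map (fun x => x + v) = ν
  rectangle : ∀ (R : ℕ → Set ℝ) (β : ℝ≥0∞), IsOrdinaryRectangle R β → ν (univ.pi R) = β

/-- The infimum of the volumes of the ordinary rectangles that contain `X`. -/
noncomputable def rectangleContent (X : Set (ℕ → ℝ)) : ℝ≥0∞ :=
  ⨅ (R : ℕ → Set ℝ) (β : ℝ≥0∞) (_ : IsOrdinaryRectangle R β) (_ : X ⊆ univ.pi R), β

theorem rectangleContent_le {X : Set (ℕ → ℝ)} {R : ℕ → Set ℝ} {β : ℝ≥0∞}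
    (h : IsOrdinaryRectangle R β) (hX : X ⊆ univ.pi R) : rectangleContent X ≤ β :=
  iInf_le_of_le R (iInf_le_of_le β (iInf_le_of_le h (iInf_le_of_le hX le_rfl)))

theorem le_rectangleContent {X : Set (ℕ → ℝ)} {c : ℝ≥0∞}
    (h : ∀ R β, IsOrdinaryRectangle R β → X ⊆ univ.pi R → c ≤ β) : c ≤ rectangleContent X :=
  le_iInf fun R => le_iInf fun β => le_iInf fun hR => le_iInf fun hX => h R β hR hX

theorem rectangleContent_empty : rectangleContent ∅ = 0 := by
  refine le_antisymm (rectangleContent_le (R := fun _ => ∅) ⟨fun _ => MeasurableSet.empty,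
    ENNReal.zero_ne_top, ?_⟩ (empty_subset _)) (zero_le)
  refine tendsto_const_nhds.congr' ?_
  filter_upwards [eventually_gt_atTop 0] with n hn
  simp [Finset.prod_const, hn.ne']

/-- The outer measure `X ↦ inf ∑ vol(R_j)` over the countable covers of `X` by ordinary
rectangles `R_j`. -/
noncomputable def ordinaryLebesgueOuter : OuterMeasure (ℕ → ℝ) :=
  OuterMeasure.ofFunction rectangleContent rectangleContent_empty

theorem IsOrdinaryRectangle.split {R : ℕ → Set ℝ} {β : ℝ≥0∞} (h : IsOrdinaryRectangle R β)
    (i : ℕ) {B : Set ℝ} (hB : MeasurableSet B) :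
    ∃ β₁ β₂ : ℝ≥0∞, IsOrdinaryRectangle (Function.update R i (R i ∩ B)) β₁ ∧
      IsOrdinaryRectangle (Function.update R i (R i \ B)) β₂ ∧ β₁ + β₂ ≤ β := by
  obtain ⟨hm, hf, hp⟩ := h
  have key : ∀ A : Set ℝ, ∀ n, i < n →
      ∏ j ∈ Finset.range n, volume (Function.update R i A j) =
        volume A * ∏ j ∈ (Finset.range n).erase i, volume (R j) := by
    intro A n hn
    rw [← Finset.mul_prod_erase _ _ (Finset.mem_range.2 hn), Function.update_self]
    congr 1
    refine Finset.prod_congr rfl fun j hj => ?_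
    rw [Function.update_of_ne (Finset.ne_of_mem_erase hj)]
  have hmeas : ∀ A : Set ℝ, MeasurableSet A → ∀ j, MeasurableSet (Function.update R i A j) := by
    intro A hA j
    rcases eq_or_ne j i with rfl | hj
    · simpa using hA
    · simpa [Function.update_of_ne hj] using hm j
  have hsum : volume (R i ∩ B) + volume (R i \ B) = volume (R i) := measure_inter_add_sdiff _ hB
  set g : ℕ → ℝ≥0∞ := fun n => ∏ j ∈ (Finset.range n).erase i, volume (R j) with hg
  have hp' : Tendsto (fun n => volume (R i) * g n) atTop (𝓝 β) := by
    refine hp.congr' ?_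
    filter_upwards [eventually_gt_atTop i] with n hn
    have := key (R i) n hn
    rwa [Function.update_eq_self] at this
  have mk : ∀ (A : Set ℝ) (γ : ℝ≥0∞), MeasurableSet A → γ ≠ ∞ →
      Tendsto (fun n => volume A * g n) atTop (𝓝 γ) →
      IsOrdinaryRectangle (Function.update R i A) γ := by
    intro A γ hA hγ hT
    refine ⟨hmeas A hA, hγ, hT.congr' ?_⟩
    filter_upwards [eventually_gt_atTop i] with n hn
    exact (key A n hn).symm
  have hA₁ := (hm i).inter hB
  have hA₂ := (hm i).diff hB
  have zero_case : (∀ A : Set ℝ, A ⊆ R i → Tendsto (fun n => volume A * g n) atTop (𝓝 0)) →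
      ∃ β₁ β₂ : ℝ≥0∞, IsOrdinaryRectangle (Function.update R i (R i ∩ B)) β₁ ∧
      IsOrdinaryRectangle (Function.update R i (R i \ B)) β₂ ∧ β₁ + β₂ ≤ β := fun h0 =>
    ⟨0, 0, mk _ 0 hA₁ ENNReal.zero_ne_top (h0 _ inter_subset_left),
      mk _ 0 hA₂ ENNReal.zero_ne_top (h0 _ sdiff_subset), by simp⟩
  rcases eq_or_ne (volume (R i)) 0 with ha | ha
  · refine zero_case fun A hA => ?_
    simp [measure_mono_null hA ha]
  rcases eq_or_ne (volume (R i)) ∞ with ha' | ha'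
  · refine zero_case fun A _ => ?_
    refine tendsto_const_nhds.congr' ?_
    filter_upwards [hp'.eventually_lt_const (lt_top_iff_ne_top.2 hf)] with n hn
    have : g n = 0 := by
      by_contra hne
      rw [ha', ENNReal.top_mul hne] at hn
      exact lt_irrefl _ hn
    simp [this]
  · have hgt : Tendsto g atTop (𝓝 ((volume (R i))⁻¹ * β)) := by
      have := ENNReal.Tendsto.const_mul (a := (volume (R i))⁻¹) hp'
        (Or.inr (ENNReal.inv_ne_top.2 ha))
      refine this.congr fun n => ?_
      rw [← mul_assoc, ENNReal.inv_mul_cancel ha ha', one_mul]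
    have hle : ∀ A : Set ℝ, A ⊆ R i → volume A ≠ ∞ := fun A hA =>
      ne_top_of_le_ne_top ha' (measure_mono hA)
    have hL : (volume (R i))⁻¹ * β ≠ ∞ := ENNReal.mul_ne_top (ENNReal.inv_ne_top.2 ha) hf
    refine ⟨_, _,
      mk _ (volume (R i ∩ B) * ((volume (R i))⁻¹ * β)) hA₁
        (ENNReal.mul_ne_top (hle _ inter_subset_left) hL)
        (ENNReal.Tendsto.const_mul hgt (Or.inr (hle _ inter_subset_left))),
      mk _ (volume (R i \ B) * ((volume (R i))⁻¹ * β)) hA₂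
        (ENNReal.mul_ne_top (hle _ sdiff_subset) hL)
        (ENNReal.Tendsto.const_mul hgt (Or.inr (hle _ sdiff_subset))), ?_⟩
    rw [← add_mul, hsum, ← mul_assoc, ENNReal.mul_inv_cancel ha ha', one_mul]

theorem le_caratheodory_ordinaryLebesgueOuter :
    (inferInstance : MeasurableSpace (ℕ → ℝ)) ≤ ordinaryLebesgueOuter.caratheodory := by
  refine iSup_le fun i => ?_
  rintro _ ⟨B, hB, rfl⟩
  refine OuterMeasure.ofFunction_caratheodory fun X => ?_
  refine le_rectangleContent fun R β hR hX => ?_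
  obtain ⟨β₁, β₂, h₁, h₂, hle⟩ := hR.split i hB
  refine le_trans (add_le_add (rectangleContent_le h₁ ?_) (rectangleContent_le h₂ ?_)) hle
  · rintro x ⟨hx, hxB⟩ j -
    rcases eq_or_ne j i with rfl | hj
    · simpa using ⟨hX hx j (mem_univ j), hxB⟩
    · simpa [Function.update_of_ne hj] using hX hx j (mem_univ j)
  · rintro x ⟨hx, hxB⟩ j -
    rcases eq_or_ne j i with rfl | hj
    · simpa using ⟨hX hx j (mem_univ j), hxB⟩
    · simpa [Function.update_of_ne hj] using hX hx j (mem_univ j)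

/-- The ordinary `(1,1,…)`-Lebesgue measure `μ_{(1,1,…)}` on the Borel sets of `ℝ^∞`. -/
noncomputable def ordinaryLebesgue : Measure (ℕ → ℝ) :=
  ordinaryLebesgueOuter.toMeasure le_caratheodory_ordinaryLebesgueOuter

theorem ordinaryLebesgueOuter_preimage_le (v : ℕ → ℝ) (X : Set (ℕ → ℝ)) :
    ordinaryLebesgueOuter ((fun x => x + v) ⁻¹' X) ≤ ordinaryLebesgueOuter X := by
  have : OuterMeasure.map (fun x => x + v) ordinaryLebesgueOuter ≤ ordinaryLebesgueOuter := by
    refine OuterMeasure.le_ofFunction.2 fun s => ?_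
    rw [OuterMeasure.map_apply]
    refine (OuterMeasure.ofFunction_le _).trans (le_rectangleContent fun R β hR hs => ?_)
    refine rectangleContent_le (R := fun i => (fun y => y + v i) ⁻¹' R i)
      ⟨fun i => measurable_add_const _ (hR.measurable i), hR.finite, ?_⟩ ?_
    · have := hR.product
      unfold IsOrdinaryProduct at this ⊢
      simpa only [measure_preimage_add_right] using this
    · intro x hx i hi
      exact hs hx i hi
  exact this X

/-- The measure constructed above is an ordinary `(1,1,…)`-Lebesgue measure. -/
theorem isOrdinaryLebesgueMeasure_ordinaryLebesgue :
    IsOrdinaryLebesgueMeasure ordinaryLebesgue := by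
  refine ⟨fun v => ?_, fun R β hR => ?_⟩
  · ext s hs
    have hmv : ∀ w : ℕ → ℝ, Measurable fun x : ℕ → ℝ => x + w := fun w => measurable_add_const w
    rw [Measure.map_apply (hmv v) hs, ordinaryLebesgue, toMeasure_apply _ _ hs,
      toMeasure_apply _ _ (hmv v hs)]
    refine le_antisymm (ordinaryLebesgueOuter_preimage_le v s) ?_
    have := ordinaryLebesgueOuter_preimage_le (-v) ((fun x => x + v) ⁻¹' s)
    rw [← preimage_comp] at this
    simpa [Function.comp_def] using this
  · rw [ordinaryLebesgue, toMeasure_apply _ _ (MeasurableSet.univ_pi hR.measurable)]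
    refine le_antisymm ((OuterMeasure.ofFunction_le _).trans
      (rectangleContent_le hR subset_rfl)) ?_
    rcases eq_or_ne β 0 with rfl | hβ
    · exact zero_le
    have hpos : ∀ i, volume (R i) ≠ 0 := by
      intro i hi
      refine hβ (tendsto_nhds_unique hR.product (tendsto_const_nhds.congr' ?_))
      filter_upwards [eventually_gt_atTop i] with n hn
      exact (Finset.prod_eq_zero (Finset.mem_range.2 hn) hi).symm
    have hfin : ∀ i, volume (R i) ≠ ∞ := by
      intro i hi
      refine hR.finite (tendsto_nhds_unique hR.product (tendsto_const_nhds.congr' ?_))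
      filter_upwards [eventually_gt_atTop i] with n hn
      rw [← Finset.mul_prod_erase _ _ (Finset.mem_range.2 hn), hi, ENNReal.top_mul]
      exact Finset.prod_ne_zero_iff.2 fun j _ => hpos j
    let p : ℕ → Measure ℝ := fun i => (volume (R i))⁻¹ • volume.restrict (R i)
    have hp : ∀ i, IsProbabilityMeasure (p i) := fun i =>
      ⟨by simp [p, ENNReal.inv_mul_cancel (hpos i) (hfin i)]⟩
    let P : Measure (ℕ → ℝ) := Measure.infinitePi p
    have hP1 : P (univ.pi R) = 1 := by
      have hae : ∀ᵐ x ∂P, ∀ i, x i ∈ R i := by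
        refine ae_all_iff.2 fun i => ?_
        have hmap : P.map (fun x => x i) = p i := Measure.infinitePi_map_eval p i
        have : ∀ᵐ y ∂(P.map fun x => x i), y ∈ R i := by
          rw [hmap]
          exact (Measure.ae_ennreal_smul_measure_iff (by simp [hfin i])).2
            (ae_restrict_mem (hR.measurable i))
        exact ae_of_ae_map (measurable_pi_apply i).aemeasurable this
      have : P (univ.pi R) = P univ := by
        refine measure_congr ?_
        filter_upwards [hae] with x hx
        exact propext ⟨fun _ => trivial, fun _ i _ => hx i⟩
      simpa using this
    have hle : β • P.toOuterMeasure ≤ ordinaryLebesgueOuter := by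
      refine OuterMeasure.le_ofFunction.2 fun s => le_rectangleContent fun R' β' hR' hs => ?_
      have hn : ∀ n, (∏ i ∈ Finset.range n, volume (R i)) * P s ≤
          ∏ i ∈ Finset.range n, volume (R' i) := by
        intro n
        have h1 : P s ≤ ∏ i ∈ Finset.range n, p i (R' i) := by
          rw [← Measure.infinitePi_pi p (fun i _ => hR'.measurable i)]
          exact measure_mono fun x hx i _ => hs hx i (mem_univ i)
        refine (mul_le_mul_right h1 _).trans ?_
        rw [← Finset.prod_mul_distrib]
        refine Finset.prod_le_prod' fun i _ => ?_
        simp only [p, Measure.smul_apply, smul_eq_mul, ← mul_assoc,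
          ENNReal.mul_inv_cancel (hpos i) (hfin i), one_mul]
        exact Measure.restrict_apply_le _ _
      exact le_of_tendsto_of_tendsto'
        (ENNReal.Tendsto.mul_const hR.product (Or.inr (measure_ne_top P s))) hR'.product hn
    have := hle (univ.pi R)
    simpa [hP1] using this

/-! ## The satisfaction problem of consumers demands -/

section Supply

variable {E : Type*} [MeasurableSpace E]

/-- An operator of global choice for sets of subsets of `E`. -/
def IsChoiceOperator (choice : Set (Set E) → Set E) : Prop :=
  ∀ F : Set (Set E), F.Nonempty → choice F ∈ F

/-- The Borel subsets of `S` of measure `c`. -/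
def demandClass (ν : Measure E) (S : Set E) (c : ℝ) : Set (Set E) :=
  {X | MeasurableSet X ∧ X ⊆ S ∧ ν X = ENNReal.ofReal c}

/-- The set offered to consumer `k` (consumers are numbered from `0`) at time `t k`, when the
initial system is `Y` and consumer `k` takes away the set chosen by `choice` among the Borel
subsets of measure `m k` of what is offered. -/
def offered (Φ : ℝ → E → E) (ν : Measure E) (choice : Set (Set E) → Set E) (t m : ℕ → ℝ)
    (Y : Set E) : ℕ → Set E
  | 0 => Φ (t 0) '' Y
  | k + 1 => Φ (t (k + 1) - t k) ''
      (offered Φ ν choice t m Y k \ choice (demandClass ν (offered Φ ν choice t m Y k) (m k)))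

/-- Each of the consumers `0, …, n - 1` receives a Borel subset, of measure `m k`, of the set
offered to him. -/
def DemandsSatisfied (Φ : ℝ → E → E) (ν : Measure E) (choice : Set (Set E) → Set E) (n : ℕ)
    (t m : ℕ → ℝ) (Y : Set E) : Prop :=
  ∀ k < n, choice (demandClass ν (offered Φ ν choice t m Y k) (m k)) ∈
    demandClass ν (offered Φ ν choice t m Y k) (m k)

/-- The real number `M` solves the problem: it is the minimal measure of an initial system (a Borel
set of positive measure) that satisfies the demands of all `n` consumers. -/
def IsSPCDSolution (Φ : ℝ → E → E) (ν : Measure E) (choice : Set (Set E) → Set E) (n : ℕ)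
    (t m : ℕ → ℝ) (M : ℝ) : Prop :=
  IsLeast {c : ℝ≥0∞ | ∃ Y : Set E, MeasurableSet Y ∧ 0 < ν Y ∧
    DemandsSatisfied Φ ν choice n t m Y ∧ ν Y = c} (ENNReal.ofReal M)

/-! ## Behaviour of a flow with respect to a measure -/

def IsStableFlow (Φ : ℝ → E → E) (ν : Measure E) : Prop :=
  ∀ (t : ℝ) (D : Set E), 0 < t → MeasurableSet D → 0 < ν D → ν D < ∞ → ν (Φ t '' D) = ν D

def IsExpansibleFlow (Φ : ℝ → E → E) (ν : Measure E) : Prop :=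
  ∀ (t₁ t₂ : ℝ) (D : Set E), 0 < t₁ → t₁ < t₂ → MeasurableSet D → 0 < ν D → ν D < ∞ →
    ν (Φ t₁ '' D) < ν (Φ t₂ '' D)

def IsPressingFlow (Φ : ℝ → E → E) (ν : Measure E) : Prop :=
  ∀ (t₁ t₂ : ℝ) (D : Set E), 0 < t₁ → t₁ < t₂ → MeasurableSet D → 0 < ν D → ν D < ∞ →
    ν (Φ t₂ '' D) < ν (Φ t₁ '' D)

def IsTotallyExpansibleFlow (Φ : ℝ → E → E) (ν : Measure E) : Prop :=
  ∀ (t : ℝ) (D : Set E), 0 < t → MeasurableSet D → 0 < ν D → ν D < ∞ → ν (Φ t '' D) = ∞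

def IsTotallyPressingFlow (Φ : ℝ → E → E) (ν : Measure E) : Prop :=
  ∀ (t : ℝ) (D : Set E), 0 < t → MeasurableSet D → 0 < ν D → ν D < ∞ → ν (Φ t '' D) = 0

end Supply

/-- The infinite generalised Malthusian flow `Φ_t(a) = (e^{t λ_k} a_k)_k` on `ℝ^∞`. -/
noncomputable def malthusianFlow (lam : ℕ → ℝ) (t : ℝ) (a : ℕ → ℝ) : ℕ → ℝ :=
  fun k => Real.exp (t * lam k) * a k

/-! Write `S_n` for the partial sums of the exponents. The flow multiplies the `n`-th partial
product of a rectangle by `exp (t * S_n)`. If `S_n → L`, it therefore scales the measure by `exp (t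
* L)` (`ordinaryLebesgue_image`), and a share `m k` taken at time `t k` costs `m k * exp (-(t k) *
L)` at time `0`. Adding the costs gives the balance `ordinaryLebesgue_eq_add_offered`. Together with
the fact that sets of finite measure have Borel subsets of every smaller measure, the balance yields
(1), whatever the choices.

For the converse direction, `exists_tendsto_exp_of_finite_image` shows that a single non-null set of
finite measure whose image under the time-`s` map has finite measure forces `exp (s * S_n)` to
converge. For pressing, expansible and stable flows the limit cannot be `0`, so `S_n` converges and
(2) reduces to (1).

In (3), a totally pressing flow offers the first consumer a null set. For a totally expansible flow,
the first share and its image at time `0` both have finite measure, so either `S_n` converges, which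
contradicts total expansion, or `S_n → ∞`. In the latter case there are null sets so rich that at
the time of consumer `k` they still contain a set of measure `m k` after any earlier withdrawals
(`exists_null_set_rich`). Systems of arbitrarily small positive measure then satisfy the demands,
and no least measure exists. Rich null sets are grids of very many cells, and a random cell avoids
the withdrawals up to a null set. -/

/-! ### Ordinary rectangles: sides, covers and proportions -/

theorem IsOrdinaryRectangle.volume_ne_zero {R : ℕ → Set ℝ} {β : ℝ≥0∞}
    (h : IsOrdinaryRectangle R β) (hβ : β ≠ 0) (i : ℕ) : volume (R i) ≠ 0 := by
  intro hi
  refine hβ (tendsto_nhds_unique h.product (tendsto_const_nhds.congr' ?_))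
  filter_upwards [eventually_gt_atTop i] with n hn
  exact (Finset.prod_eq_zero (Finset.mem_range.2 hn) hi).symm

/-- Null sides have to be excluded: since `0 * ∞ = 0`, a rectangle of volume `0` may have sides of
infinite length. -/
theorem IsOrdinaryRectangle.volume_ne_top {R : ℕ → Set ℝ} {β : ℝ≥0∞}
    (h : IsOrdinaryRectangle R β) (hR : ∀ i, volume (R i) ≠ 0) (i : ℕ) : volume (R i) ≠ ∞ := by
  intro hi
  refine h.finite (tendsto_nhds_unique h.product (tendsto_const_nhds.congr' ?_))
  filter_upwards [eventually_gt_atTop i] with n hn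
  rw [← Finset.mul_prod_erase _ _ (Finset.mem_range.2 hn), hi, ENNReal.top_mul]
  exact Finset.prod_ne_zero_iff.2 fun j _ => hR j

theorem ordinaryLebesgue_pi {R : ℕ → Set ℝ} {β : ℝ≥0∞} (h : IsOrdinaryRectangle R β) :
    ordinaryLebesgue (univ.pi R) = β :=
  isOrdinaryLebesgueMeasure_ordinaryLebesgue.rectangle R β h

theorem ordinaryLebesgue_apply {X : Set (ℕ → ℝ)} (hX : MeasurableSet X) :
    ordinaryLebesgue X = ordinaryLebesgueOuter X :=
  toMeasure_apply _ _ hX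

/-- A set of finite measure is covered by countably many ordinary rectangles. -/
theorem exists_ordinaryRectangle_cover {X : Set (ℕ → ℝ)} (hX : ordinaryLebesgue X ≠ ∞) :
    ∃ (R : ℕ → ℕ → Set ℝ) (β : ℕ → ℝ≥0∞), (∀ j, IsOrdinaryRectangle (R j) (β j)) ∧
      X ⊆ ⋃ j, univ.pi (R j) := by
  have h1 : ordinaryLebesgueOuter X < ∞ :=
    lt_of_le_of_lt (le_toMeasure_apply _ _ _) (lt_top_iff_ne_top.2 hX)
  rw [ordinaryLebesgueOuter, OuterMeasure.ofFunction_apply, iInf_lt_iff] at h1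
  obtain ⟨s, hs⟩ := h1
  rw [iInf_lt_iff] at hs
  obtain ⟨hcov, hs⟩ := hs
  have : ∀ j, ∃ (R : ℕ → Set ℝ) (β : ℝ≥0∞), IsOrdinaryRectangle R β ∧ s j ⊆ univ.pi R := by
    intro j
    have hj : rectangleContent (s j) < ∞ := lt_of_le_of_lt (ENNReal.le_tsum j) hs
    simp only [rectangleContent, iInf_lt_iff] at hj
    obtain ⟨R, β, h, h', -⟩ := hj
    exact ⟨R, β, h, h'⟩
  choose R β h h' using this
  exact ⟨R, β, h, hcov.trans (iUnion_mono h')⟩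

/-- A rectangle inside an ordinary rectangle has at most the proportion given by its first sides. -/
theorem ordinaryLebesgue_pi_le_of_subset {R B : ℕ → Set ℝ} {β : ℝ≥0∞}
    (h : IsOrdinaryRectangle R β) (hB : ∀ i, MeasurableSet (B i)) (hBR : ∀ i, B i ⊆ R i) (n : ℕ) :
    ordinaryLebesgue (univ.pi B) ≤ (∏ i ∈ Finset.range n, volume (B i) / volume (R i)) * β := by
  rcases eq_or_ne β 0 with rfl | hβ
  · rw [mul_zero, ← ordinaryLebesgue_pi h]
    exact measure_mono (pi_mono fun i _ => hBR i)
  have h0 := h.volume_ne_zero hβ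
  have ht := h.volume_ne_top h0
  have hBt : ∀ i, volume (B i) ≠ ∞ := fun i => ne_top_of_le_ne_top (ht i) (measure_mono (hBR i))
  set c := ∏ i ∈ Finset.range n, volume (B i) / volume (R i) with hc
  have hct : c ≠ ∞ := ENNReal.prod_ne_top fun i _ => ENNReal.div_ne_top (hBt i) (h0 i)
  -- Only the first `n` sides are shrunk; the unchanged tail of `R` still supplies the limit.
  have hrect : IsOrdinaryRectangle (fun i => if i < n then B i else R i) (c * β) := by
    refine ⟨fun i => ?_, ENNReal.mul_ne_top hct h.finite, ?_⟩
    · split_ifs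
      exacts [hB i, h.measurable i]
    · refine (ENNReal.Tendsto.const_mul h.product (Or.inr hct)).congr' ?_
      filter_upwards [eventually_ge_atTop n] with N hN
      obtain ⟨k, rfl⟩ := Nat.exists_eq_add_of_le hN
      rw [Finset.prod_range_add, Finset.prod_range_add, ← mul_assoc, hc,
        ← Finset.prod_mul_distrib]
      congr 1
      · refine Finset.prod_congr rfl fun i hi => ?_
        rw [if_pos (Finset.mem_range.1 hi), ENNReal.div_mul_cancel (h0 i) (ht i)]
      · refine Finset.prod_congr rfl fun i _ => ?_
        rw [if_neg (by omega)]
  rw [← ordinaryLebesgue_pi hrect]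
  refine measure_mono (pi_mono fun i _ => ?_)
  split_ifs
  exacts [subset_rfl, hBR i]

/-! ## The flow -/

/-- The coordinates of `malthusianFlow lam t '' univ.pi R`. -/
def flowSide (lam : ℕ → ℝ) (t : ℝ) (R : ℕ → Set ℝ) (i : ℕ) : Set ℝ :=
  (fun y => Real.exp (-t * lam i) * y) ⁻¹' R i

theorem malthusianFlow_add (lam : ℕ → ℝ) (s t : ℝ) (a : ℕ → ℝ) :
    malthusianFlow lam s (malthusianFlow lam t a) = malthusianFlow lam (s + t) a := by
  funext k
  simp only [malthusianFlow]
  rw [← mul_assoc, ← Real.exp_add, add_mul]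

theorem malthusianFlow_zero (lam : ℕ → ℝ) (a : ℕ → ℝ) : malthusianFlow lam 0 a = a := by
  funext k
  simp [malthusianFlow]

theorem image_malthusianFlow (lam : ℕ → ℝ) (t : ℝ) (X : Set (ℕ → ℝ)) :
    malthusianFlow lam t '' X = malthusianFlow lam (-t) ⁻¹' X := by
  refine congrFun (image_eq_preimage_of_inverse ?_ ?_) X <;> intro a <;>
    simp [malthusianFlow_add, malthusianFlow_zero]

theorem image_image_malthusianFlow (lam : ℕ → ℝ) (s t : ℝ) (X : Set (ℕ → ℝ)) :
    malthusianFlow lam s '' (malthusianFlow lam t '' X) = malthusianFlow lam (s + t) '' X := by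
  rw [image_image]
  simp only [malthusianFlow_add]

theorem image_zero_malthusianFlow (lam : ℕ → ℝ) (X : Set (ℕ → ℝ)) :
    malthusianFlow lam 0 '' X = X := by
  simp [malthusianFlow_zero]

theorem injective_malthusianFlow (lam : ℕ → ℝ) (t : ℝ) :
    Function.Injective (malthusianFlow lam t) := by
  intro a b h
  have := congrArg (malthusianFlow lam (-t)) h
  simpa [malthusianFlow_add, malthusianFlow_zero] using this

theorem measurable_malthusianFlow (lam : ℕ → ℝ) (t : ℝ) : Measurable (malthusianFlow lam t) :=
  measurable_pi_lambda _ fun k => (measurable_pi_apply k).const_mul _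

theorem measurableSet_image_malthusianFlow (lam : ℕ → ℝ) (t : ℝ) {X : Set (ℕ → ℝ)}
    (hX : MeasurableSet X) : MeasurableSet (malthusianFlow lam t '' X) := by
  rw [image_malthusianFlow]
  exact measurable_malthusianFlow lam (-t) hX

theorem image_pi_malthusianFlow (lam : ℕ → ℝ) (t : ℝ) (R : ℕ → Set ℝ) :
    malthusianFlow lam t '' univ.pi R = univ.pi (flowSide lam t R) := by
  rw [image_malthusianFlow]
  ext a
  simp [malthusianFlow, flowSide]

theorem measurableSet_flowSide (lam : ℕ → ℝ) (t : ℝ) {R : ℕ → Set ℝ} {i : ℕ}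
    (h : MeasurableSet (R i)) : MeasurableSet (flowSide lam t R i) :=
  (measurable_const_mul _) h

theorem volume_flowSide (lam : ℕ → ℝ) (t : ℝ) (R : ℕ → Set ℝ) (i : ℕ) :
    volume (flowSide lam t R i) = ENNReal.ofReal (Real.exp (t * lam i)) * volume (R i) := by
  rw [flowSide, Real.volume_preimage_mul_left (Real.exp_pos _).ne', ← Real.exp_neg,
    abs_of_pos (Real.exp_pos _)]
  simp

theorem prod_volume_flowSide (lam : ℕ → ℝ) (t : ℝ) (R : ℕ → Set ℝ) (n : ℕ) :
    ∏ i ∈ Finset.range n, volume (flowSide lam t R i) =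
      ENNReal.ofReal (Real.exp (t * ∑ i ∈ Finset.range n, lam i)) *
        ∏ i ∈ Finset.range n, volume (R i) := by
  simp only [volume_flowSide]
  rw [Finset.prod_mul_distrib, ← ENNReal.ofReal_prod_of_nonneg fun i _ => (Real.exp_pos _).le,
    ← Real.exp_sum, Finset.mul_sum]

theorem IsOrdinaryRectangle.flowSide {lam : ℕ → ℝ} {t : ℝ} {R : ℕ → Set ℝ} {β : ℝ≥0∞} {ℓ : ℝ}
    (h : IsOrdinaryRectangle R β)
    (hl : Tendsto (fun n => Real.exp (t * ∑ i ∈ Finset.range n, lam i)) atTop (𝓝 ℓ)) :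
    IsOrdinaryRectangle (flowSide lam t R) (ENNReal.ofReal ℓ * β) := by
  refine ⟨fun i => measurableSet_flowSide lam t (h.measurable i),
    ENNReal.mul_ne_top ENNReal.ofReal_ne_top h.finite, ?_⟩
  unfold IsOrdinaryProduct
  simp only [prod_volume_flowSide]
  exact ENNReal.Tendsto.mul (ENNReal.tendsto_ofReal hl) (Or.inr h.finite) h.product
    (Or.inr ENNReal.ofReal_ne_top)

theorem tendsto_exp_mul_sum {lam : ℕ → ℝ} {L : ℝ}
    (hL : Tendsto (fun n => ∑ i ∈ Finset.range n, lam i) atTop (𝓝 L)) (t : ℝ) :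
    Tendsto (fun n => Real.exp (t * ∑ i ∈ Finset.range n, lam i)) atTop (𝓝 (Real.exp (t * L))) :=
  (Real.continuous_exp.tendsto _).comp (hL.const_mul t)

/-- On rectangles the scaling is explicit, and the outer measure is the largest one below
`rectangleContent`, so the rescaled transported outer measure lies below it. The reverse inequality
comes from applying this one at time `-t`. -/
theorem ordinaryLebesgue_image_le {lam : ℕ → ℝ} {L : ℝ}
    (hL : Tendsto (fun n => ∑ i ∈ Finset.range n, lam i) atTop (𝓝 L)) (t : ℝ)
    {X : Set (ℕ → ℝ)} (hX : MeasurableSet X) :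
    ordinaryLebesgue (malthusianFlow lam t '' X) ≤
      ENNReal.ofReal (Real.exp (t * L)) * ordinaryLebesgue X := by
  set c := ENNReal.ofReal (Real.exp (t * L)) with hc
  have hc0 : c ≠ 0 := by simp [hc, Real.exp_pos]
  rw [ordinaryLebesgue_apply hX,
    ordinaryLebesgue_apply (measurableSet_image_malthusianFlow lam t hX), image_malthusianFlow]
  have key : c⁻¹ • OuterMeasure.map (malthusianFlow lam (-t)) ordinaryLebesgueOuter ≤
      ordinaryLebesgueOuter := by
    refine OuterMeasure.le_ofFunction.2 fun s => ?_
    simp only [FunLike.coe_smul, Pi.smul_apply, OuterMeasure.map_apply, smul_eq_mul]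
    refine le_rectangleContent fun R β hR hs => ?_
    have h1 : ordinaryLebesgueOuter (malthusianFlow lam (-t) ⁻¹' s) ≤ c * β := by
      refine (OuterMeasure.ofFunction_le _).trans
        (rectangleContent_le (hR.flowSide (tendsto_exp_mul_sum hL t)) ?_)
      rw [← image_pi_malthusianFlow, image_malthusianFlow]
      exact preimage_mono hs
    calc c⁻¹ * ordinaryLebesgueOuter (malthusianFlow lam (-t) ⁻¹' s) ≤ c⁻¹ * (c * β) := by gcongr
      _ = β := by
        rw [← mul_assoc, ENNReal.inv_mul_cancel hc0 ENNReal.ofReal_ne_top, one_mul]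
  have h2 := key X
  simp only [FunLike.coe_smul, Pi.smul_apply, OuterMeasure.map_apply, smul_eq_mul] at h2
  calc ordinaryLebesgueOuter (malthusianFlow lam (-t) ⁻¹' X)
      = c * (c⁻¹ * ordinaryLebesgueOuter (malthusianFlow lam (-t) ⁻¹' X)) := by
        rw [← mul_assoc, ENNReal.mul_inv_cancel hc0 ENNReal.ofReal_ne_top, one_mul]
    _ ≤ _ := by gcongr

theorem ordinaryLebesgue_image {lam : ℕ → ℝ} {L : ℝ}
    (hL : Tendsto (fun n => ∑ i ∈ Finset.range n, lam i) atTop (𝓝 L)) (t : ℝ)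
    {X : Set (ℕ → ℝ)} (hX : MeasurableSet X) :
    ordinaryLebesgue (malthusianFlow lam t '' X) =
      ENNReal.ofReal (Real.exp (t * L)) * ordinaryLebesgue X := by
  refine le_antisymm (ordinaryLebesgue_image_le hL t hX) ?_
  have h := ordinaryLebesgue_image_le hL (-t) (measurableSet_image_malthusianFlow lam t hX)
  rw [image_image_malthusianFlow, neg_add_cancel, image_zero_malthusianFlow] at h
  calc _ ≤ ENNReal.ofReal (Real.exp (t * L)) * (ENNReal.ofReal (Real.exp (-t * L)) *
        ordinaryLebesgue (malthusianFlow lam t '' X)) := by gcongr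
    _ = _ := by
      rw [← mul_assoc, ← ENNReal.ofReal_mul (Real.exp_pos _).le, ← Real.exp_add]
      simp

/-! ## Borel subsets of prescribed measure -/

/-- One null side among sides of infinite length makes the partial products vanish, by `0 * ∞ = 0`.
-/
theorem ordinaryLebesgue_hyperplane (r : ℝ) : ordinaryLebesgue {x : ℕ → ℝ | x 0 = r} = 0 := by
  have h : IsOrdinaryRectangle (fun i => if i = 0 then {r} else univ) 0 := by
    refine ⟨fun i => ?_, ENNReal.zero_ne_top, tendsto_const_nhds.congr' ?_⟩
    · split_ifs
      exacts [measurableSet_singleton r, MeasurableSet.univ]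
    · filter_upwards [eventually_gt_atTop 0] with n hn
      exact (Finset.prod_eq_zero (Finset.mem_range.2 hn) (by simp)).symm
  refine measure_mono_null ?_ (ordinaryLebesgue_pi h)
  intro x hx i _
  dsimp only
  split_ifs with hi
  exacts [hi ▸ hx, trivial]

/-- A Borel set of finite measure has Borel subsets of every smaller measure. -/
theorem exists_subset_ordinaryLebesgue_eq {S : Set (ℕ → ℝ)} (hS : MeasurableSet S)
    (hfin : ordinaryLebesgue S ≠ ∞) {c : ℝ≥0∞} (hc : c ≤ ordinaryLebesgue S) :
    ∃ X, MeasurableSet X ∧ X ⊆ S ∧ ordinaryLebesgue X = c := by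
  rcases eq_or_ne c (ordinaryLebesgue S) with rfl | hne
  · exact ⟨S, hS, subset_rfl, rfl⟩
  rcases eq_or_ne c 0 with rfl | hc0
  · exact ⟨∅, MeasurableSet.empty, empty_subset _, measure_empty⟩
  have hlt : c < ordinaryLebesgue S := lt_of_le_of_ne hc hne
  -- The law of the first coordinate on `S` is finite and has no atoms, so its distribution function
  -- is continuous and takes the value `c`; the required subset is a slice of `S` by a half-space.
  set κ : Measure ℝ := (ordinaryLebesgue.restrict S).map (fun x => x 0) with hκ
  have hm0 : Measurable fun x : ℕ → ℝ => x 0 := measurable_pi_apply 0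
  have happ : ∀ B, MeasurableSet B → κ B = ordinaryLebesgue ((fun x => x 0) ⁻¹' B ∩ S) := by
    intro B hB
    rw [hκ, Measure.map_apply hm0 hB, Measure.restrict_apply (hm0 hB)]
  have huniv : κ univ = ordinaryLebesgue S := by simp [happ univ MeasurableSet.univ]
  have : IsFiniteMeasure κ := ⟨by rw [huniv]; exact lt_top_iff_ne_top.2 hfin⟩
  have : NullSingletonClass κ := ⟨fun r => by
    rw [happ _ (measurableSet_singleton r)]
    exact measure_mono_null inter_subset_left (ordinaryLebesgue_hyperplane r)⟩
  have hcont : Continuous fun r => κ (Iic r) := by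
    refine continuous_iff_continuousAt.2 fun r =>
      tendsto_measure_of_ae_tendsto_indicator_of_isFiniteMeasure (𝓝 r) measurableSet_Iic
        (fun _ => measurableSet_Iic) ?_
    have hne : ∀ᵐ x ∂κ, x ≠ r := by simp [ae_iff]
    filter_upwards [hne] with x hx
    rcases lt_or_gt_of_ne hx with h | h
    · filter_upwards [eventually_gt_nhds h] with y hy
      simp [hy.le, h.le]
    · filter_upwards [eventually_lt_nhds h] with y hy
      simp [hy.not_ge, h.not_ge]
  have htop : Tendsto (fun r => κ (Iic r)) atTop (𝓝 (κ univ)) := tendsto_measure_Iic_atTop κ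
  have hbot : Tendsto (fun r => κ (Iic r)) atBot (𝓝 0) := by
    rw [← measure_empty (μ := κ)]
    refine tendsto_measure_of_ae_tendsto_indicator_of_isFiniteMeasure atBot MeasurableSet.empty
        (fun _ => measurableSet_Iic) (ae_of_all _ fun x => ?_)
    filter_upwards [eventually_lt_atBot x] with y hy
    simp [hy]
  obtain ⟨a, ha⟩ := (hbot.eventually_lt_const (pos_iff_ne_zero.2 hc0)).exists
  obtain ⟨b, hb⟩ := (htop.eventually_const_lt (huniv ▸ hlt)).exists
  obtain ⟨r, hr⟩ := mem_range_of_exists_le_of_exists_ge hcont ⟨a, ha.le⟩ ⟨b, hb.le⟩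
  exact ⟨_, (hm0 measurableSet_Iic).inter hS, inter_subset_right,
    (happ _ measurableSet_Iic).symm.trans hr⟩

/-! ## Boxes -/

theorem isOrdinaryRectangle_box (c : ℝ) :
    IsOrdinaryRectangle (fun i => if i = 0 then Ico 0 c else Ico 0 1) (ENNReal.ofReal c) := by
  refine ⟨fun i => ?_, ENNReal.ofReal_ne_top, tendsto_const_nhds.congr' ?_⟩
  · split_ifs
    exacts [measurableSet_Ico, measurableSet_Ico]
  · filter_upwards [eventually_gt_atTop 0] with n hn
    rw [← Finset.mul_prod_erase _ _ (Finset.mem_range.2 hn), Finset.prod_eq_one]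
    · simp
    · intro i hi
      simp [Finset.ne_of_mem_erase hi]

/-- A box of measure `c`, for `0 ≤ c`. -/
def box (c : ℝ) : Set (ℕ → ℝ) := univ.pi fun i => if i = 0 then Ico 0 c else Ico 0 1

theorem measurableSet_box (c : ℝ) : MeasurableSet (box c) :=
  MeasurableSet.univ_pi (isOrdinaryRectangle_box c).measurable

theorem ordinaryLebesgue_box (c : ℝ) : ordinaryLebesgue (box c) = ENNReal.ofReal c :=
  ordinaryLebesgue_pi (isOrdinaryRectangle_box c)

/-! ## Sets of finite measure along the flow -/

theorem exists_tendsto_prod_of_le_one {f : ℕ → ℝ} (h0 : ∀ i, 0 ≤ f i) (h1 : ∀ i, f i ≤ 1) :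
    ∃ p, Tendsto (fun n => ∏ i ∈ Finset.range n, f i) atTop (𝓝 p) := by
  refine ⟨_, tendsto_atTop_ciInf (antitone_nat_of_succ_le fun n => ?_)
    ⟨0, by rintro _ ⟨n, rfl⟩; exact Finset.prod_nonneg fun i _ => h0 i⟩⟩
  rw [Finset.prod_range_succ]
  exact mul_le_of_le_one_right (Finset.prod_nonneg fun i _ => h0 i) (h1 n)

/-- If a set and its image under `malthusianFlow lam s` have finite measure, and the set is not
null, then the factors `exp (s * ∑ i < n, lam i)` converge. -/
theorem exists_tendsto_exp_of_finite_image {lam : ℕ → ℝ} {s : ℝ} {Z : Set (ℕ → ℝ)}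
    (h0 : ordinaryLebesgue Z ≠ 0) (hfin : ordinaryLebesgue Z ≠ ∞)
    (hfin' : ordinaryLebesgue (malthusianFlow lam s '' Z) ≠ ∞) :
    ∃ ℓ, Tendsto (fun n => Real.exp (s * ∑ i ∈ Finset.range n, lam i)) atTop (𝓝 ℓ) := by
  obtain ⟨R, β, hR, hcov⟩ := exists_ordinaryRectangle_cover hfin
  obtain ⟨R', β', hR', hcov'⟩ := exists_ordinaryRectangle_cover hfin'
  -- Covering both the set and its image, some rectangle `Q` of the first cover and some pulled-back
  -- rectangle `Q'` of the second overlap in a non-null set.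
  obtain ⟨j, l, hjl⟩ : ∃ j l,
      ordinaryLebesgue (univ.pi (R j) ∩ malthusianFlow lam (-s) '' univ.pi (R' l)) ≠ 0 := by
    by_contra! hcon
    refine h0 (measure_mono_null ?_ (measure_iUnion_null fun j => measure_iUnion_null (hcon j)))
    intro x hx
    obtain ⟨j, hj⟩ := mem_iUnion.1 (hcov hx)
    obtain ⟨l, hl⟩ := mem_iUnion.1 (hcov' (mem_image_of_mem _ hx))
    refine mem_iUnion₂.2 ⟨j, l, hj, _, hl, ?_⟩
    rw [malthusianFlow_add, neg_add_cancel, malthusianFlow_zero]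
  rw [image_pi_malthusianFlow, ← pi_inter_distrib] at hjl
  have hRj := hR j
  have hRl := hR' l
  generalize R j = Q at *
  generalize R' l = Q' at *
  generalize β j = b at *
  generalize β' l = b' at *
  set B : ℕ → Set ℝ := fun i => Q i ∩ flowSide lam (-s) Q' i with hB
  have hBm : ∀ i, MeasurableSet (B i) := fun i =>
    (hRj.measurable i).inter (measurableSet_flowSide _ _ (hRl.measurable i))
  have hbound := ordinaryLebesgue_pi_le_of_subset hRj hBm fun i => inter_subset_left
  have hb : b ≠ 0 := by
    rintro rfl
    exact hjl (by simpa using hbound 0)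
  have hQ0 := hRj.volume_ne_zero hb
  have hQt := hRj.volume_ne_top hQ0
  have hBt : ∀ i, volume (B i) ≠ ∞ := fun i =>
    ne_top_of_le_ne_top (hQt i) (measure_mono inter_subset_left)
  have hB0 : ∀ i, volume (B i) ≠ 0 := by
    intro i hi
    have := hbound (i + 1)
    rw [Finset.prod_range_succ, hi] at this
    exact hjl (by simpa using this)
  have hBQ' : ∀ i, volume (B i) ≤
      ENNReal.ofReal (Real.exp (-s * lam i)) * volume (Q' i) := fun i => by
    rw [← volume_flowSide]
    exact measure_mono inter_subset_right
  have hQ'0 : ∀ i, volume (Q' i) ≠ 0 := fun i hi => hB0 i (by simpa [hi] using hBQ' i)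
  have hQ't := hRl.volume_ne_top hQ'0
  set q : ℕ → ℝ := fun i => (volume (Q i)).toReal with hq
  set q' : ℕ → ℝ := fun i => (volume (Q' i)).toReal with hq'
  set r : ℕ → ℝ := fun i => (volume (B i)).toReal with hr
  have hqpos : ∀ i, 0 < q i := fun i => ENNReal.toReal_pos (hQ0 i) (hQt i)
  have hq'pos : ∀ i, 0 < q' i := fun i => ENNReal.toReal_pos (hQ'0 i) (hQ't i)
  have hrpos : ∀ i, 0 < r i := fun i => ENNReal.toReal_pos (hB0 i) (hBt i)
  have hrq : ∀ i, r i ≤ q i := fun i =>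
    ENNReal.toReal_mono (hQt i) (measure_mono inter_subset_left)
  have hrq' : ∀ i, r i * Real.exp (s * lam i) ≤ q' i := fun i => by
    have := ENNReal.toReal_mono (ENNReal.mul_ne_top ENNReal.ofReal_ne_top (hQ't i)) (hBQ' i)
    rw [ENNReal.toReal_mul, ENNReal.toReal_ofReal (Real.exp_pos _).le] at this
    calc r i * Real.exp (s * lam i)
        ≤ Real.exp (-s * lam i) * q' i * Real.exp (s * lam i) := by gcongr
      _ = Real.exp (-s * lam i) * Real.exp (s * lam i) * q' i := by ring
      _ = q' i := by rw [← Real.exp_add]; simp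
  have hqlim : Tendsto (fun n => ∏ i ∈ Finset.range n, q i) atTop (𝓝 b.toReal) := by
    simpa only [hq, ← ENNReal.toReal_prod, Function.comp_def] using
      (ENNReal.tendsto_toReal hRj.finite).comp hRj.product
  have hq'lim : Tendsto (fun n => ∏ i ∈ Finset.range n, q' i) atTop (𝓝 b'.toReal) := by
    simpa only [hq', ← ENNReal.toReal_prod, Function.comp_def] using
      (ENNReal.tendsto_toReal hRl.finite).comp hRl.product
  obtain ⟨ρ, hρ⟩ := exists_tendsto_prod_of_le_one (f := fun i => r i / q i)
    (fun i => (div_pos (hrpos i) (hqpos i)).le) fun i => (div_le_one (hqpos i)).2 (hrq i)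
  obtain ⟨σ, hσ⟩ := exists_tendsto_prod_of_le_one
    (f := fun i => r i * Real.exp (s * lam i) / q' i)
    (fun i => (div_pos (mul_pos (hrpos i) (Real.exp_pos _)) (hq'pos i)).le)
    fun i => (div_le_one (hq'pos i)).2 (hrq' i)
  have hbpos : 0 < b.toReal := ENNReal.toReal_pos hb hRj.finite
  have hμt : ordinaryLebesgue (univ.pi B) ≠ ∞ :=
    ne_top_of_le_ne_top hRj.finite (by simpa using hbound 0)
  -- The overlap has positive measure, and every partial product of `r i / q i` bounds its
  -- proportion in `Q` from above.
  have hρpos : 0 < ρ := by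
    have hlow : ∀ n, (ordinaryLebesgue (univ.pi B)).toReal / b.toReal ≤
        ∏ i ∈ Finset.range n, r i / q i := fun n => by
      rw [div_le_iff₀ hbpos]
      have := ENNReal.toReal_mono (ENNReal.mul_ne_top (ENNReal.prod_ne_top fun i _ =>
        ENNReal.div_ne_top (hBt i) (hQ0 i)) hRj.finite) (hbound n)
      simpa only [ENNReal.toReal_mul, ENNReal.toReal_prod, ENNReal.toReal_div] using this
    exact (div_pos (ENNReal.toReal_pos hjl hμt) hbpos).trans_le
      (ge_of_tendsto' hρ hlow)
  -- Factorwise, `exp (s * lam i) = (q' i / q i) * (r i * exp (s * lam i) / q' i) / (r i / q i)`,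
  -- and each product of factors on the right converges.
  refine ⟨_, (((hq'lim.div hqlim hbpos.ne').mul hσ).div hρ hρpos.ne').congr fun n => ?_⟩
  simp only [Pi.div_apply]
  rw [← Finset.prod_div_distrib, ← Finset.prod_mul_distrib, ← Finset.prod_div_distrib,
    Finset.mul_sum, Real.exp_sum]
  refine Finset.prod_congr rfl fun i _ => ?_
  have h1 := (hqpos i).ne'
  have h2 := (hq'pos i).ne'
  have h3 := (hrpos i).ne'
  field_simp

theorem tendsto_sum_or_tendsto_atBot {lam : ℕ → ℝ} {s : ℝ} (hs : s ≠ 0) {ℓ : ℝ}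
    (h : Tendsto (fun n => Real.exp (s * ∑ i ∈ Finset.range n, lam i)) atTop (𝓝 ℓ)) :
    (∃ L, Tendsto (fun n => ∑ i ∈ Finset.range n, lam i) atTop (𝓝 L)) ∨
      Tendsto (fun n => s * ∑ i ∈ Finset.range n, lam i) atTop atBot := by
  rcases eq_or_ne ℓ 0 with rfl | hℓ
  · exact Or.inr (Real.tendsto_exp_comp_nhds_zero.1 h)
  · refine Or.inl ⟨s⁻¹ * Real.log ℓ, ?_⟩
    have := (h.log hℓ).const_mul s⁻¹
    simpa [Real.log_exp, inv_mul_cancel_left₀ hs] using this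

/-- Finiteness at time `s` leaves only convergence or divergence to `-∞`; the latter would make the
image of the box null at every positive time, including `u`. -/
theorem exists_tendsto_sum_of_box {lam : ℕ → ℝ} {s u : ℝ} (hs : 0 < s) (hu : 0 < u)
    (hfin : ordinaryLebesgue (malthusianFlow lam s '' box 1) ≠ ∞)
    (hpos : ordinaryLebesgue (malthusianFlow lam u '' box 1) ≠ 0) :
    ∃ L, Tendsto (fun n => ∑ i ∈ Finset.range n, lam i) atTop (𝓝 L) := by
  obtain ⟨ℓ, hℓ⟩ := exists_tendsto_exp_of_finite_image (by simp [ordinaryLebesgue_box])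
    (by simp [ordinaryLebesgue_box]) hfin
  refine (tendsto_sum_or_tendsto_atBot hs.ne' hℓ).resolve_right fun hbot => hpos ?_
  have hbot' : Tendsto (fun n => u * ∑ i ∈ Finset.range n, lam i) atTop atBot := by
    have := hbot.const_mul_atBot (div_pos hu hs)
    refine this.congr fun n => ?_
    field_simp
  have := (isOrdinaryRectangle_box 1).flowSide (Real.tendsto_exp_comp_nhds_zero.2 hbot')
  rw [box, image_pi_malthusianFlow, ordinaryLebesgue_pi this]
  simp

/-! ## The satisfaction problem -/

theorem measurableSet_offered {lam : ℕ → ℝ} {choice : Set (Set (ℕ → ℝ)) → Set (ℕ → ℝ)}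
    {t m : ℕ → ℝ} {Y : Set (ℕ → ℝ)} (hY : MeasurableSet Y) {k : ℕ}
    (hsat : DemandsSatisfied (malthusianFlow lam) ordinaryLebesgue choice k t m Y) :
    MeasurableSet (offered (malthusianFlow lam) ordinaryLebesgue choice t m Y k) := by
  induction k with
  | zero => exact measurableSet_image_malthusianFlow _ _ hY
  | succ k ih =>
    exact measurableSet_image_malthusianFlow _ _
      ((ih fun j hj => hsat j (hj.trans k.lt_succ_self)).diff (hsat k k.lt_succ_self).1)

/-- Balance at time `0`: the initial measure is the discounted value of the shares already taken
plus that of the set now on offer. -/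
theorem ordinaryLebesgue_eq_add_offered {lam : ℕ → ℝ} {L : ℝ}
    (hL : Tendsto (fun n => ∑ i ∈ Finset.range n, lam i) atTop (𝓝 L))
    {choice : Set (Set (ℕ → ℝ)) → Set (ℕ → ℝ)} {t m : ℕ → ℝ} {Y : Set (ℕ → ℝ)}
    (hY : MeasurableSet Y) {k : ℕ} (hm : ∀ j < k, 0 < m j)
    (hsat : DemandsSatisfied (malthusianFlow lam) ordinaryLebesgue choice k t m Y) :
    ordinaryLebesgue Y = ENNReal.ofReal (∑ j ∈ Finset.range k, m j * Real.exp (-(t j) * L)) +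
      ENNReal.ofReal (Real.exp (-(t k) * L)) *
        ordinaryLebesgue (offered (malthusianFlow lam) ordinaryLebesgue choice t m Y k) := by
  have hexp : ∀ a b : ℝ, ENNReal.ofReal (Real.exp (a * L)) * ENNReal.ofReal (Real.exp (b * L)) =
      ENNReal.ofReal (Real.exp ((a + b) * L)) := fun a b => by
    rw [← ENNReal.ofReal_mul (Real.exp_pos _).le, ← Real.exp_add, add_mul]
  induction k with
  | zero =>
    rw [offered, ordinaryLebesgue_image hL _ hY, ← mul_assoc, hexp]
    simp
  | succ k ih =>
    have hsat' : DemandsSatisfied (malthusianFlow lam) ordinaryLebesgue choice k t m Y :=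
      fun j hj => hsat j (hj.trans k.lt_succ_self)
    have hm' : ∀ j < k, 0 < m j := fun j hj => hm j (hj.trans k.lt_succ_self)
    obtain ⟨h1, h2, h3⟩ := hsat k k.lt_succ_self
    rw [ih hm' hsat', offered, ordinaryLebesgue_image hL _ ((measurableSet_offered hY hsat').diff h1),
      ← mul_assoc, hexp, Finset.sum_range_succ, ENNReal.ofReal_add
        (Finset.sum_nonneg fun j hj => mul_nonneg (hm' j (Finset.mem_range.1 hj)).le
          (Real.exp_pos _).le) (mul_nonneg (hm k k.lt_succ_self).le (Real.exp_pos _).le),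
      ← measure_inter_add_sdiff (offered (malthusianFlow lam) ordinaryLebesgue choice t m Y k) h1,
      inter_eq_right.2 h2, h3, mul_add, add_assoc, ENNReal.ofReal_mul (hm k k.lt_succ_self).le,
      mul_comm (ENNReal.ofReal (m k))]
    congr 4
    ring_nf

/-- By the balance, what is left for consumer `k` is worth exactly the discounted demands `k, …, n -
1`. It is therefore finite and at least `m k`, so his demand class is nonempty. -/
theorem demandsSatisfied_of_ordinaryLebesgue_eq {lam : ℕ → ℝ} {L : ℝ}
    (hL : Tendsto (fun n => ∑ i ∈ Finset.range n, lam i) atTop (𝓝 L))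
    {choice : Set (Set (ℕ → ℝ)) → Set (ℕ → ℝ)} (hchoice : IsChoiceOperator choice) {n : ℕ}
    {t m : ℕ → ℝ} (hm : ∀ k < n, 0 < m k) {Y : Set (ℕ → ℝ)} (hY : MeasurableSet Y)
    (hμ : ordinaryLebesgue Y =
      ENNReal.ofReal (∑ k ∈ Finset.range n, m k * Real.exp (-(t k) * L))) :
    DemandsSatisfied (malthusianFlow lam) ordinaryLebesgue choice n t m Y := by
  intro k hk
  induction k using Nat.strong_induction_on with
  | _ k ih =>
    have hsat : DemandsSatisfied (malthusianFlow lam) ordinaryLebesgue choice k t m Y :=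
      fun j hj => ih j hj (hj.trans hk)
    have hbal := ordinaryLebesgue_eq_add_offered hL hY (fun j hj => hm j (hj.trans hk)) hsat
    have hnn : ∀ j < n, 0 ≤ m j * Real.exp (-(t j) * L) := fun j hj =>
      mul_nonneg (hm j hj).le (Real.exp_pos _).le
    set S := offered (malthusianFlow lam) ordinaryLebesgue choice t m Y k with hS
    have hsplit : ordinaryLebesgue Y =
        ENNReal.ofReal (∑ j ∈ Finset.range k, m j * Real.exp (-(t j) * L)) +
        ENNReal.ofReal (∑ j ∈ Finset.Ico k n, m j * Real.exp (-(t j) * L)) := by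
      rw [hμ, ← ENNReal.ofReal_add (Finset.sum_nonneg fun j hj =>
          hnn j ((Finset.mem_range.1 hj).trans hk)) (Finset.sum_nonneg fun j hj =>
          hnn j (Finset.mem_Ico.1 hj).2), Finset.sum_range_add_sum_Ico _ hk.le]
    have hrest := (ENNReal.add_right_inj ENNReal.ofReal_ne_top).1 (hbal.symm.trans hsplit)
    have hc0 : ENNReal.ofReal (Real.exp (-(t k) * L)) ≠ 0 := by simp [Real.exp_pos]
    have hfin : ordinaryLebesgue S ≠ ∞ := by
      intro h
      rw [h, ENNReal.mul_top hc0] at hrest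
      exact ENNReal.ofReal_ne_top hrest.symm
    have hle : ENNReal.ofReal (m k) ≤ ordinaryLebesgue S := by
      rw [← ENNReal.mul_le_mul_iff_right hc0 ENNReal.ofReal_ne_top, hrest,
        ← ENNReal.ofReal_mul (Real.exp_pos _).le, mul_comm]
      exact ENNReal.ofReal_le_ofReal (Finset.single_le_sum
        (f := fun j => m j * Real.exp (-(t j) * L))
        (fun j hj => hnn j (Finset.mem_Ico.1 hj).2) (Finset.mem_Ico.2 ⟨le_rfl, hk⟩))
    obtain ⟨X, h1, h2, h3⟩ :=
      exists_subset_ordinaryLebesgue_eq (measurableSet_offered hY hsat) hfin hle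
    exact hchoice _ ⟨X, h1, h2, h3⟩

theorem ordinaryLebesgue_offered_last {lam : ℕ → ℝ} {L : ℝ}
    (hL : Tendsto (fun n => ∑ i ∈ Finset.range n, lam i) atTop (𝓝 L))
    {choice : Set (Set (ℕ → ℝ)) → Set (ℕ → ℝ)} {n : ℕ}
    {t m : ℕ → ℝ} (hm : ∀ k < n + 1, 0 < m k) {Y : Set (ℕ → ℝ)} (hY : MeasurableSet Y)
    (hμ : ordinaryLebesgue Y =
      ENNReal.ofReal (∑ k ∈ Finset.range (n + 1), m k * Real.exp (-(t k) * L)))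
    (hsat : DemandsSatisfied (malthusianFlow lam) ordinaryLebesgue choice (n + 1) t m Y) :
    ordinaryLebesgue (offered (malthusianFlow lam) ordinaryLebesgue choice t m Y n) =
      ENNReal.ofReal (m n) := by
  have hm' : ∀ j < n, 0 < m j := fun j hj => hm j (hj.trans n.lt_succ_self)
  have hbal := ordinaryLebesgue_eq_add_offered hL hY hm'
    (fun j hj => hsat j (hj.trans n.lt_succ_self))
  rw [hμ, Finset.sum_range_succ, ENNReal.ofReal_add
        (Finset.sum_nonneg fun j hj => mul_nonneg (hm' j (Finset.mem_range.1 hj)).le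
          (Real.exp_pos _).le) (mul_nonneg (hm n n.lt_succ_self).le (Real.exp_pos _).le),
    ENNReal.add_right_inj ENNReal.ofReal_ne_top, mul_comm, ENNReal.ofReal_mul (Real.exp_pos _).le,
    ENNReal.mul_right_inj (by simp [Real.exp_pos]) ENNReal.ofReal_ne_top] at hbal
  exact hbal.symm

theorem isSPCDSolution_of_tendsto {lam : ℕ → ℝ} {L : ℝ}
    (hL : Tendsto (fun n => ∑ i ∈ Finset.range n, lam i) atTop (𝓝 L))
    {choice : Set (Set (ℕ → ℝ)) → Set (ℕ → ℝ)} (hchoice : IsChoiceOperator choice) {n : ℕ}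
    (hn : 1 ≤ n) {t m : ℕ → ℝ} (hm : ∀ k < n, 0 < m k) :
    IsSPCDSolution (malthusianFlow lam) ordinaryLebesgue choice n t m
      (∑ k ∈ Finset.range n, m k * Real.exp (-(t k) * L)) := by
  constructor
  · refine ⟨box _, measurableSet_box _, ?_, ?_, ordinaryLebesgue_box _⟩
    · rw [ordinaryLebesgue_box, ENNReal.ofReal_pos]
      exact Finset.sum_pos (fun k hk => mul_pos (hm k (Finset.mem_range.1 hk)) (Real.exp_pos _))
        ⟨0, Finset.mem_range.2 hn⟩
    · exact demandsSatisfied_of_ordinaryLebesgue_eq hL hchoice hm (measurableSet_box _)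
        (ordinaryLebesgue_box _)
  · rintro _ ⟨Y, hY, -, hsat, rfl⟩
    -- The balance after all `n` consumers; the remainder, which involves `t n` beyond the last
    -- consumer, is nonnegative and dropped.
    rw [ordinaryLebesgue_eq_add_offered hL hY hm hsat]
    exact le_self_add

/-! ## Null sets that satisfy every demand of an expanding flow -/

/-- Powers of two with exponents that grow more slowly than `a * S`, but along a subsequence
faster than `b * S`. -/
theorem exists_pow_between {S : ℕ → ℝ} (hS : Tendsto S atTop atTop) {a b : ℝ} (hb : 0 ≤ b)
    (hab : b < a) :
    ∃ d : ℕ → ℕ, Monotone d ∧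
      Tendsto (fun n => (2 : ℝ) ^ d n * Real.exp (-a * S n)) atTop (𝓝 0) ∧
      ∃ u : ℕ → ℕ, Tendsto u atTop atTop ∧
        Tendsto (fun n => Real.exp (b * S (u n)) / (2 : ℝ) ^ d (u n)) atTop (𝓝 0) := by
  -- `S (u n)` is the minimum of `S` over the indices from `n` on: a monotone minorant of `S`, equal
  -- to `S` at the indices `u n`.
  have hmin : ∀ n, ∃ k ∈ Ici n, ∀ j ∈ Ici n, S k ≤ S j := fun n =>
    Filter.Tendsto.exists_within_forall_le ⟨n, le_refl n⟩ (Nat.cofinite_eq_atTop ▸ hS)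
  choose u hu hmin using hmin
  have hut : Tendsto u atTop atTop := tendsto_atTop_mono hu tendsto_id
  have huu : ∀ n, S (u (u n)) = S (u n) := fun n =>
    le_antisymm (hmin _ _ (le_refl (u n))) (hmin n _ (show n ≤ u (u n) from le_trans (hu n) (hu (u n))))
  set c := (a + b) / 2 with hc
  have hcpos : 0 < c := by linarith
  have hlog : 0 < Real.log 2 := Real.log_pos one_lt_two
  have h2 : ∀ k : ℕ, (2 : ℝ) ^ k = Real.exp (k * Real.log 2) := fun k => by
    rw [← Real.rpow_natCast, Real.rpow_def_of_pos two_pos, mul_comm]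
  have hev : ∀ᶠ n in atTop, 0 ≤ S n := hS.eventually_ge_atTop 0
  -- Thus `2 ^ d n` is about `exp (c * S (u n))`, with `c` strictly between `b` and `a`.
  refine ⟨fun n => ⌊c / Real.log 2 * S (u n)⌋₊, fun i j hij => ?_, ?_, u, hut, ?_⟩
  · refine Nat.floor_mono (mul_le_mul_of_nonneg_left ?_ (by positivity))
    exact hmin i _ (le_trans hij (hu j))
  · have hlim : Tendsto (fun n => Real.exp ((c - a) * S n)) atTop (𝓝 0) :=
      Real.tendsto_exp_comp_nhds_zero.2 (hS.const_mul_atTop_of_neg (by linarith))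
    refine squeeze_zero' (Eventually.of_forall fun n => by positivity) ?_ hlim
    filter_upwards [hut.eventually hev] with n hn
    rw [h2, ← Real.exp_add, Real.exp_le_exp]
    have h3 : (⌊c / Real.log 2 * S (u n)⌋₊ : ℝ) ≤ c / Real.log 2 * S (u n) :=
      Nat.floor_le (by positivity)
    have h4 : (⌊c / Real.log 2 * S (u n)⌋₊ : ℝ) * Real.log 2 ≤ c * S (u n) := by
      calc _ ≤ c / Real.log 2 * S (u n) * Real.log 2 := by gcongr
        _ = _ := by field_simp
    have h5 : c * S (u n) ≤ c * S n := by
      gcongr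
      exact hmin n n (le_refl n)
    linarith
  -- The summand `Real.log 2` pays for the factor of at most two lost to the floor.
  · have hlim : Tendsto (fun n => Real.exp (Real.log 2 + (b - c) * S (u n))) atTop (𝓝 0) :=
      Real.tendsto_exp_comp_nhds_zero.2 (tendsto_atBot_add_const_left _ _
        ((hS.comp hut).const_mul_atTop_of_neg (by linarith)))
    refine squeeze_zero (fun n => by positivity) (fun n => ?_) hlim
    dsimp only
    rw [h2, ← Real.exp_sub, Real.exp_le_exp, huu]
    have h3 : c / Real.log 2 * S (u n) < ⌊c / Real.log 2 * S (u n)⌋₊ + 1 := Nat.lt_floor_add_one _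
    have h4 : c * S (u n) ≤ (⌊c / Real.log 2 * S (u n)⌋₊ + 1) * Real.log 2 := by
      calc c * S (u n) = c / Real.log 2 * S (u n) * Real.log 2 := by field_simp
        _ ≤ _ := by gcongr
    linarith

/-- The `x`-th interval of length `c` (if `i = 0`) or `1` (if `i ≠ 0`). -/
def cellSide (c : ℝ) (i x : ℕ) : Set ℝ :=
  Ico (x * if i = 0 then c else 1) ((x + 1) * if i = 0 then c else 1)

theorem measurableSet_cellSide (c : ℝ) (i x : ℕ) : MeasurableSet (cellSide c i x) :=
  measurableSet_Ico

theorem volume_cellSide (c : ℝ) (i x : ℕ) :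
    volume (cellSide c i x) = ENNReal.ofReal (if i = 0 then c else 1) := by
  rw [cellSide, Real.volume_Ico]
  ring_nf

theorem pairwise_disjoint_cellSide {c : ℝ} (hc : 0 < c) (i : ℕ) :
    Pairwise (Function.onFun Disjoint (cellSide c i)) := by
  have hq : 0 < (if i = 0 then c else 1 : ℝ) := by split_ifs <;> linarith
  refine (pairwise_disjoint_on _).2 fun x y hxy => ?_
  rw [cellSide, cellSide, Ico_disjoint_Ico]
  refine (min_le_left _ _).trans (le_trans ?_ (le_max_right _ _))
  exact mul_le_mul_of_nonneg_right (by exact_mod_cast hxy) hq.le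

theorem prod_side {c : ℝ} {n : ℕ} (hn : 0 < n) :
    ∏ i ∈ Finset.range n, (if i = 0 then c else 1 : ℝ) = c := by
  rw [Finset.prod_ite_eq' (Finset.range n) 0 fun _ => c, if_pos (Finset.mem_range.2 hn)]

theorem isOrdinaryRectangle_cell {c : ℝ} (hc : 0 < c) (x : ℕ → ℕ) :
    IsOrdinaryRectangle (fun i => cellSide c i (x i)) (ENNReal.ofReal c) := by
  refine ⟨fun i => measurableSet_cellSide _ _ _, ENNReal.ofReal_ne_top,
    tendsto_const_nhds.congr' ?_⟩
  filter_upwards [eventually_gt_atTop 0] with n hn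
  simp only [volume_cellSide]
  rw [← ENNReal.ofReal_prod_of_nonneg fun i _ => by split_ifs <;> linarith, prod_side hn]

/-- Among the cells of a grid there is one that meets in a null set each of countably many
rectangles that occupy a vanishing proportion of the grid. -/
theorem exists_cell_inter_null {ι : Type*} [Countable ι] {c : ℝ} (hc : 0 < c) {N : ℕ → ℕ}
    (hN : ∀ i, N i ≠ 0) {A : ι → ℕ → Set ℝ} (hA : ∀ l i, MeasurableSet (A l i))
    (h : ∀ l, ⨅ n, ∏ i ∈ Finset.range n,
      (N i : ℝ≥0∞)⁻¹ * (volume (A l i) / ENNReal.ofReal (if i = 0 then c else 1)) = 0) :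
    ∃ x : ℕ → ℕ, (∀ i, x i < N i) ∧
      ∀ l, ordinaryLebesgue (univ.pi (fun i => cellSide c i (x i)) ∩ univ.pi (A l)) = 0 := by
  -- A cell is drawn at random, with independent uniform coordinates; `g l i` is the proportion of
  -- its `i`-th side inside `A l i`.
  let P : (i : ℕ) → Measure (Fin (N i)) := fun i => (N i : ℝ≥0∞)⁻¹ • Measure.count
  have hP : ∀ i, IsProbabilityMeasure (P i) := fun i => ⟨by
    simp [P, Measure.count_apply, ENNReal.inv_mul_cancel, hN i]⟩
  let g : ι → (i : ℕ) → Fin (N i) → ℝ≥0∞ := fun l i x =>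
    volume (cellSide c i x ∩ A l i) / volume (cellSide c i x)
  have hgm : ∀ l i, Measurable (g l i) := fun l i => measurable_of_countable _
  have hgm' : ∀ l i, Measurable fun x : (i : ℕ) → Fin (N i) => g l i (x i) := fun l i =>
    (hgm l i).comp (measurable_pi_apply i)
  have hg : ∀ l i, ∫⁻ x, g l i x ∂(P i) ≤
      (N i : ℝ≥0∞)⁻¹ * (volume (A l i) / ENNReal.ofReal (if i = 0 then c else 1)) := by
    intro l i
    simp only [P, g, lintegral_smul_measure, lintegral_count, tsum_fintype, volume_cellSide,
      smul_eq_mul, div_eq_mul_inv]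
    rw [← Finset.sum_mul]
    gcongr
    rw [← measure_biUnion_finset]
    · exact measure_mono (iUnion₂_subset fun _ _ => inter_subset_right)
    · intro x _ y _ hxy
      exact (pairwise_disjoint_cellSide hc i fun h => hxy (Fin.ext h)).mono inter_subset_left
        inter_subset_left
    · exact fun x _ => (measurableSet_cellSide _ _ _).inter (hA l i)
  have hae : ∀ᵐ x ∂(Measure.infinitePi P), ∀ l,
      ⨅ n, ∏ i ∈ Finset.range n, g l i (x i) = 0 := by
    refine ae_all_iff.2 fun l => ?_
    have hmeas : Measurable fun x : (i : ℕ) → Fin (N i) =>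
        ⨅ n, ∏ i ∈ Finset.range n, g l i (x i) :=
      Measurable.iInf fun n => Finset.measurable_fun_prod _ fun i _ => hgm' l i
    refine (lintegral_eq_zero_iff hmeas).1 (le_antisymm ?_ zero_le)
    rw [← h l]
    -- By independence, the expected product of the first `n` proportions is at most the `n`-th
    -- product in `h`.
    refine le_iInf fun n => (lintegral_mono fun x => iInf_le _ n).trans ?_
    rw [ProbabilityTheory.lintegral_prod_eq_prod_lintegral_of_indepFun _ _
      (ProbabilityTheory.iIndepFun_infinitePi (hgm l)) (hgm' l)]
    refine Finset.prod_le_prod' fun i _ => ?_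
    rw [(measurePreserving_eval_infinitePi P i).lintegral_comp (hgm l i)]
    exact hg l i
  obtain ⟨x, hx⟩ := hae.exists
  refine ⟨fun i => x i, fun i => (x i).2, fun l => ?_⟩
  rw [← pi_inter_distrib]
  have hbound := ordinaryLebesgue_pi_le_of_subset (isOrdinaryRectangle_cell hc fun i => x i)
    (fun i => (measurableSet_cellSide _ _ _).inter (hA l i)) fun i => inter_subset_left
  have hdiv : ordinaryLebesgue (univ.pi fun i => cellSide c i (x i) ∩ A l i) /
      ENNReal.ofReal c ≤ 0 := by
    rw [← hx l]
    exact le_iInf fun n => ENNReal.div_le_of_le_mul (hbound n)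
  exact (ENNReal.div_eq_zero_iff.1 (le_antisymm hdiv zero_le)).resolve_right
    ENNReal.ofReal_ne_top

/-- `W` is a grid of cells of measure `c`, pulled back from time `τ`. The number of cells in the
first `n` coordinates grows more slowly than `exp (τ * S_n)`, so `W` is null. Along a subsequence it
grows faster than `exp ((τ - t₀) * S_n)`, which bounds the growth of anything of finite measure
removed at a time `≥ t₀`, so some cell survives up to a null set. `W` is fixed before the removed
sets are known, since these depend on the choices. -/
theorem exists_null_set_rich {lam : ℕ → ℝ}
    (hlam : Tendsto (fun n => ∑ i ∈ Finset.range n, lam i) atTop atTop) {t₀ τ : ℝ} (ht₀ : 0 < t₀)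
    (hτ : t₀ ≤ τ) {c : ℝ} (hc : 0 < c) :
    ∃ W : Set (ℕ → ℝ), MeasurableSet W ∧ ordinaryLebesgue W = 0 ∧
      ∀ (k : ℕ) (C : Fin k → Set (ℕ → ℝ)) (s : Fin k → ℝ), (∀ j, MeasurableSet (C j)) →
        (∀ j, ordinaryLebesgue (C j) ≠ ∞) → (∀ j, t₀ ≤ s j) →
        ∃ X, MeasurableSet X ∧ X ⊆ malthusianFlow lam τ '' W ∧
          (∀ j, Disjoint X (malthusianFlow lam (τ - s j) '' C j)) ∧
          ordinaryLebesgue X = ENNReal.ofReal c := by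
  obtain ⟨d, hd, hd0, u, hu, hdu⟩ := exists_pow_between hlam (sub_nonneg.2 hτ) (sub_lt_self τ ht₀)
  -- The cell counts telescope to `2 ^ (d n - d 0)`.
  set N : ℕ → ℕ := fun i => 2 ^ (d (i + 1) - d i) with hN
  have hNprod : ∀ n, ∏ i ∈ Finset.range n, N i = 2 ^ (d n - d 0) := fun n => by
    rw [hN, Finset.prod_pow_eq_pow_sum, Finset.sum_range_tsub hd]
  have hpow : ∀ n, (2 : ℝ) ^ d n = 2 ^ d 0 * ∏ i ∈ Finset.range n, (N i : ℝ) := fun n => by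
    rw [← Nat.cast_prod, hNprod, Nat.cast_pow, Nat.cast_ofNat, ← pow_add,
      Nat.add_sub_cancel' (hd n.zero_le)]
  set q : ℕ → ℝ := fun i => if i = 0 then c else 1 with hq
  have hqpos : ∀ i, 0 < q i := fun i => by simp only [hq]; split_ifs <;> linarith
  have hNpos : ∀ i, 0 < (N i : ℝ) := fun i => by simp [hN]
  have hrect : IsOrdinaryRectangle (flowSide lam (-τ) fun i => Ico 0 (N i * q i)) 0 := by
    refine ⟨fun i => measurableSet_flowSide _ _ measurableSet_Ico, ENNReal.zero_ne_top, ?_⟩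
    have hlim : Tendsto (fun n => ENNReal.ofReal ((c / 2 ^ d 0) *
        ((2 : ℝ) ^ d n * Real.exp (-τ * ∑ i ∈ Finset.range n, lam i)))) atTop (𝓝 0) := by
      simpa using ENNReal.tendsto_ofReal (hd0.const_mul (c / 2 ^ d 0))
    refine hlim.congr' ?_
    filter_upwards [eventually_gt_atTop 0] with n hn
    rw [prod_volume_flowSide]
    simp only [Real.volume_Ico, sub_zero]
    rw [← ENNReal.ofReal_prod_of_nonneg fun i _ => (mul_pos (hNpos i) (hqpos i)).le,
      ← ENNReal.ofReal_mul (Real.exp_pos _).le, Finset.prod_mul_distrib, prod_side hn, hpow n]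
    congr 1
    field_simp
  refine ⟨malthusianFlow lam (-τ) '' univ.pi fun i => Ico 0 (N i * q i), ?_, ?_, ?_⟩
  · exact measurableSet_image_malthusianFlow _ _ (MeasurableSet.univ_pi fun i => measurableSet_Ico)
  · rw [image_pi_malthusianFlow, ordinaryLebesgue_pi hrect]
  intro k C s hC hCfin hs
  choose R β hR hcov using fun j => exists_ordinaryRectangle_cover (hCfin j)
  have hA : ∀ (p : Fin k × ℕ) (i : ℕ), MeasurableSet (flowSide lam (τ - s p.1) (R p.1 p.2) i) :=
    fun p i => measurableSet_flowSide _ _ ((hR p.1 p.2).measurable i)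
  -- Only an infimum has to vanish, so smallness along the subsequence `u` suffices.
  obtain ⟨x, hxN, hx⟩ := exists_cell_inter_null hc (N := N) (fun i => by simp [hN]) hA (by
    rintro ⟨j, l⟩
    have hlim : Tendsto (fun n => ENNReal.ofReal (2 ^ d 0 / c) *
        ENNReal.ofReal (Real.exp ((τ - t₀) * ∑ i ∈ Finset.range (u n), lam i) / 2 ^ d (u n)) *
        ∏ i ∈ Finset.range (u n), volume (R j l i)) atTop
        (𝓝 (ENNReal.ofReal (2 ^ d 0 / c) * ENNReal.ofReal 0 * β j l)) := by
      refine ENNReal.Tendsto.mul (ENNReal.Tendsto.const_mul (ENNReal.tendsto_ofReal hdu)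
        (Or.inr ENNReal.ofReal_ne_top)) (Or.inr (hR j l).finite) ((hR j l).product.comp hu)
        (Or.inr (by simp))
    rw [ENNReal.ofReal_zero, mul_zero, zero_mul] at hlim
    refine le_antisymm (ge_of_tendsto hlim ?_) zero_le
    filter_upwards [(hlam.comp hu).eventually_ge_atTop 0, hu.eventually_gt_atTop 0] with n hn hn0
    refine (iInf_le _ (u n)).trans ?_
    have hinv : ∀ i, (N i : ℝ≥0∞)⁻¹ * (volume (flowSide lam (τ - s j) (R j l) i) /
        ENNReal.ofReal (q i)) = ENNReal.ofReal ((N i * q i)⁻¹) *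
          volume (flowSide lam (τ - s j) (R j l) i) := fun i => by
      rw [ENNReal.ofReal_inv_of_pos (mul_pos (hNpos i) (hqpos i)),
        ENNReal.ofReal_mul (hNpos i).le, ENNReal.ofReal_natCast,
        ENNReal.mul_inv (Or.inr ENNReal.ofReal_ne_top) (Or.inl (ENNReal.natCast_ne_top _)),
        div_eq_mul_inv]
      ring
    simp only [hq] at hinv
    simp only [hinv]
    rw [Finset.prod_mul_distrib, prod_volume_flowSide, ← mul_assoc,
      ← ENNReal.ofReal_prod_of_nonneg fun i _ => (inv_pos.2 (mul_pos (hNpos i) (hqpos i))).le,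
      Finset.prod_inv_distrib, Finset.prod_mul_distrib, prod_side hn0,
      ← ENNReal.ofReal_mul (by positivity), ← ENNReal.ofReal_mul (by positivity), hpow (u n)]
    refine mul_le_mul_left (ENNReal.ofReal_le_ofReal ?_) _
    have hexp : Real.exp ((τ - s j) * ∑ i ∈ Finset.range (u n), lam i) ≤
        Real.exp ((τ - t₀) * ∑ i ∈ Finset.range (u n), lam i) :=
      Real.exp_le_exp.2 (mul_le_mul_of_nonneg_right (by linarith [hs j]) hn)
    have hprod : 0 < ∏ i ∈ Finset.range (u n), (N i : ℝ) := Finset.prod_pos fun i _ => hNpos i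
    calc _ ≤ ((∏ i ∈ Finset.range (u n), (N i : ℝ)) * c)⁻¹ *
          Real.exp ((τ - t₀) * ∑ i ∈ Finset.range (u n), lam i) := by gcongr
      _ = _ := by field_simp)
  set Q : Set (ℕ → ℝ) := univ.pi fun i => cellSide c i (x i) with hQ
  have hQm : MeasurableSet Q := MeasurableSet.univ_pi fun i => measurableSet_cellSide _ _ _
  have hnull : ordinaryLebesgue (Q ∩ ⋃ j, malthusianFlow lam (τ - s j) '' C j) = 0 := by
    rw [inter_iUnion]
    refine measure_iUnion_null fun j => ?_
    refine measure_mono_null ?_ (measure_iUnion_null fun l => hx (j, l))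
    rw [← inter_iUnion]
    refine inter_subset_inter_right _ ?_
    simp only [← image_pi_malthusianFlow, ← image_iUnion]
    exact image_mono (hcov j)
  have hm : MeasurableSet (⋃ j, malthusianFlow lam (τ - s j) '' C j) :=
    MeasurableSet.iUnion fun j => measurableSet_image_malthusianFlow _ _ (hC j)
  refine ⟨Q \ ⋃ j, malthusianFlow lam (τ - s j) '' C j, hQm.diff hm, ?_, fun j => ?_, ?_⟩
  · rw [image_image_malthusianFlow, add_neg_cancel, image_zero_malthusianFlow]
    refine sdiff_subset.trans (pi_mono fun i _ => Ico_subset_Ico ?_ ?_)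
    · exact mul_nonneg (Nat.cast_nonneg _) (hqpos i).le
    · exact mul_le_mul_of_nonneg_right (by exact_mod_cast hxN i) (hqpos i).le
  · exact disjoint_sdiff_left.mono_right (subset_iUnion_of_subset j subset_rfl)
  · rw [← ordinaryLebesgue_pi (isOrdinaryRectangle_cell hc x), ← hQ,
      ← measure_inter_add_sdiff Q hm, hnull, zero_add]

/-- Pulling all withdrawals back to time `0` makes the share of consumer `j` appear at time `t k` as
its image under time `t k - t j`, the form in `exists_null_set_rich`. -/
theorem offered_eq_image {lam : ℕ → ℝ} {ν : Measure (ℕ → ℝ)}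
    {choice : Set (Set (ℕ → ℝ)) → Set (ℕ → ℝ)} {t m : ℕ → ℝ} {Y : Set (ℕ → ℝ)} (k : ℕ) :
    offered (malthusianFlow lam) ν choice t m Y k =
      malthusianFlow lam (t k) '' (Y \ ⋃ j : Fin k, malthusianFlow lam (-t j) ''
        choice (demandClass ν (offered (malthusianFlow lam) ν choice t m Y j) (m j))) := by
  induction k with
  | zero => simp [offered]
  | succ k ih =>
    set C : ℕ → Set (ℕ → ℝ) := fun j =>
      choice (demandClass ν (offered (malthusianFlow lam) ν choice t m Y j) (m j)) with hC
    have hunion : ⋃ j : Fin (k + 1), malthusianFlow lam (-t j) '' C j =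
        (⋃ j : Fin k, malthusianFlow lam (-t j) '' C j) ∪ malthusianFlow lam (-t k) '' C k := by
      ext a
      simp only [mem_iUnion, mem_union, Fin.exists_fin_succ', Fin.val_castSucc, Fin.val_last]
    have hk : C k = malthusianFlow lam (t k) '' (malthusianFlow lam (-t k) '' C k) := by
      rw [image_image_malthusianFlow, add_neg_cancel, image_zero_malthusianFlow]
    rw [offered, hunion, ← sdiff_sdiff]
    change malthusianFlow lam _ '' (_ \ C k) = _
    rw [hk, ih, ← image_sdiff (injective_malthusianFlow lam (t k)), image_image_malthusianFlow,
      sub_add_cancel, ← hk]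

/-- If the partial sums of the exponents tend to infinity, then there are initial systems of
arbitrarily small measure that satisfy all demands, whatever the choices. -/
theorem exists_small_demandsSatisfied {lam : ℕ → ℝ}
    (hlam : Tendsto (fun n => ∑ i ∈ Finset.range n, lam i) atTop atTop)
    {choice : Set (Set (ℕ → ℝ)) → Set (ℕ → ℝ)} (hchoice : IsChoiceOperator choice) {n : ℕ}
    {t m : ℕ → ℝ} (ht₀ : 0 < t 0) (ht : ∀ k < n, t 0 ≤ t k) (hm : ∀ k < n, 0 < m k) {ε : ℝ} :
    ∃ Y, MeasurableSet Y ∧ ordinaryLebesgue Y = ENNReal.ofReal ε ∧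
      DemandsSatisfied (malthusianFlow lam) ordinaryLebesgue choice n t m Y := by
  choose W hW hW0 hrich using fun k : Fin n =>
    exists_null_set_rich hlam ht₀ (ht k k.2) (hm k k.2)
  -- The null sets `W k` serve the consumers; the box only supplies the prescribed measure.
  refine ⟨box ε ∪ ⋃ k, W k, (measurableSet_box ε).union (MeasurableSet.iUnion hW), ?_, ?_⟩
  · rw [measure_congr (union_ae_eq_left_of_ae_eq_empty (ae_eq_empty.2 (measure_iUnion_null hW0))),
      ordinaryLebesgue_box]
  intro k hk
  induction k using Nat.strong_induction_on with
  | _ k ih =>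
    have hC := fun j : Fin k => ih j j.2 (j.2.trans hk)
    obtain ⟨X, hXm, hXW, hXd, hX⟩ := hrich ⟨k, hk⟩ k _ (fun j => t j) (fun j => (hC j).1)
      (fun j => (hC j).2.2 ▸ ENNReal.ofReal_ne_top) fun j => ht j (j.2.trans hk)
    refine hchoice _ ⟨X, hXm, ?_, hX⟩
    rw [offered_eq_image]
    intro a ha
    obtain ⟨w, hw, rfl⟩ := hXW ha
    refine mem_image_of_mem _ ⟨Or.inr (mem_iUnion.2 ⟨_, hw⟩), fun hmem => ?_⟩
    obtain ⟨j, hj⟩ := mem_iUnion.1 hmem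
    refine disjoint_left.1 (hXd j) ha ?_
    have := mem_image_of_mem (malthusianFlow lam (t k)) hj
    rwa [image_image_malthusianFlow, ← sub_eq_add_neg] at this

/-! ### Behaviour of the flow and the main theorem -/

theorem not_isSPCDSolution_of_totallyPressing {lam : ℕ → ℝ}
    (h : IsTotallyPressingFlow (malthusianFlow lam) ordinaryLebesgue)
    {choice : Set (Set (ℕ → ℝ)) → Set (ℕ → ℝ)} {n : ℕ} (hn : 1 ≤ n) {t m : ℕ → ℝ}
    (hm : 0 < m 0) (ht₀ : 0 < t 0) (M : ℝ) :
    ¬ IsSPCDSolution (malthusianFlow lam) ordinaryLebesgue choice n t m M := by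
  rintro ⟨⟨Y, hY, hpos, hsat, hM⟩, -⟩
  have h0 := h (t 0) Y ht₀ hY hpos (hM ▸ ENNReal.ofReal_lt_top)
  obtain ⟨-, h2, h3⟩ := hsat 0 hn
  rw [measure_mono_null h2 h0] at h3
  exact absurd h3.symm (ENNReal.ofReal_pos.2 hm).ne'

theorem not_isSPCDSolution_of_totallyExpansible {lam : ℕ → ℝ}
    (h : IsTotallyExpansibleFlow (malthusianFlow lam) ordinaryLebesgue)
    {choice : Set (Set (ℕ → ℝ)) → Set (ℕ → ℝ)} (hchoice : IsChoiceOperator choice) {n : ℕ}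
    (hn : 1 ≤ n) {t m : ℕ → ℝ} (ht : ∀ k < n, t 0 ≤ t k) (hm : ∀ k < n, 0 < m k)
    (ht₀ : 0 < t 0) (M : ℝ) :
    ¬ IsSPCDSolution (malthusianFlow lam) ordinaryLebesgue choice n t m M := by
  rintro ⟨⟨Y, hY, hpos, hsat, hM⟩, hleast⟩
  have hMpos : 0 < M := ENNReal.ofReal_pos.1 (hM ▸ hpos)
  obtain ⟨-, h2, h3⟩ := hsat 0 hn
  set C := choice (demandClass ordinaryLebesgue
    (offered (malthusianFlow lam) ordinaryLebesgue choice t m Y 0) (m 0)) with hC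
  have hback : malthusianFlow lam (-t 0) '' C ⊆ Y := by
    have := image_mono (f := malthusianFlow lam (-t 0)) h2
    rwa [offered, image_image_malthusianFlow, neg_add_cancel, image_zero_malthusianFlow] at this
  -- The first share has measure `m 0`, and carried back to time `0` it lies in `Y`, which has
  -- finite measure.
  obtain ⟨ℓ, hℓ⟩ := exists_tendsto_exp_of_finite_image (lam := lam) (s := -t 0) (Z := C)
    (by rw [h3]; exact (ENNReal.ofReal_pos.2 (hm 0 hn)).ne') (h3 ▸ ENNReal.ofReal_ne_top)
    (ne_top_of_le_ne_top (hM ▸ ENNReal.ofReal_ne_top) (measure_mono hback))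
  rcases tendsto_sum_or_tendsto_atBot (neg_ne_zero.2 ht₀.ne') hℓ with ⟨L, hL⟩ | hbot
  · have htop := h (t 0) Y ht₀ hY hpos (hM ▸ ENNReal.ofReal_lt_top)
    rw [ordinaryLebesgue_image hL _ hY, hM] at htop
    exact ENNReal.mul_ne_top ENNReal.ofReal_ne_top ENNReal.ofReal_ne_top htop
  · have hlam : Tendsto (fun n => ∑ i ∈ Finset.range n, lam i) atTop atTop := by
      refine (hbot.const_mul_atBot_of_neg (neg_lt_zero.2 (inv_pos.2 ht₀))).congr fun n => ?_
      field_simp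
    obtain ⟨Y', hY', hμ, hsat'⟩ :=
      exists_small_demandsSatisfied hlam hchoice ht₀ ht hm (ε := M / 2)
    have hle := hleast ⟨Y', hY', by rw [hμ]; exact ENNReal.ofReal_pos.2 (half_pos hMpos), hsat', hμ⟩
    exact absurd hle (not_le.2 ((ENNReal.ofReal_lt_ofReal_iff hMpos).2 (half_lt_self hMpos)))

/-- A strict inequality between the measures of the unit box at times `1` and `2` makes the smaller
one finite and the larger one nonzero, which is all that `exists_tendsto_sum_of_box` needs; for
stable flows time `1` serves for both. -/
theorem exists_tendsto_sum_of_monotone_flow {lam : ℕ → ℝ}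
    (h : IsPressingFlow (malthusianFlow lam) ordinaryLebesgue ∨
      IsExpansibleFlow (malthusianFlow lam) ordinaryLebesgue ∨
      IsStableFlow (malthusianFlow lam) ordinaryLebesgue) :
    ∃ L, Tendsto (fun n => ∑ i ∈ Finset.range n, lam i) atTop (𝓝 L) := by
  have hm := measurableSet_box 1
  have h0 : 0 < ordinaryLebesgue (box 1) := by simp [ordinaryLebesgue_box]
  have h1 : ordinaryLebesgue (box 1) < ∞ := by simp [ordinaryLebesgue_box]
  rcases h with h | h | h
  · have hlt := h 1 2 (box 1) one_pos one_lt_two hm h0 h1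
    exact exists_tendsto_sum_of_box two_pos one_pos hlt.ne_top hlt.ne_bot
  · have hlt := h 1 2 (box 1) one_pos one_lt_two hm h0 h1
    exact exists_tendsto_sum_of_box one_pos two_pos hlt.ne_top hlt.ne_bot
  · have heq := h 1 (box 1) one_pos hm h0 h1
    exact exists_tendsto_sum_of_box one_pos one_pos (heq ▸ h1.ne) (heq ▸ h0.ne')

theorem mainTheorem1 (lam : ℕ → ℝ) (choice : Set (Set (ℕ → ℝ)) → Set (ℕ → ℝ))
    (hchoice : IsChoiceOperator choice) (n : ℕ) (hn : 1 ≤ n) (t m : ℕ → ℝ)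
    (ht : ∀ j k, j < k → k < n → t j < t k) (hm : ∀ k < n, 0 < m k) :
    (∀ L : ℝ, Tendsto (fun N => ∑ k ∈ Finset.range N, lam k) atTop (𝓝 L) →
      (∀ Y : Set (ℕ → ℝ), MeasurableSet Y →
        ordinaryLebesgue Y =
          ENNReal.ofReal (∑ k ∈ Finset.range n, m k * Real.exp (-(t k) * L)) →
        DemandsSatisfied (malthusianFlow lam) ordinaryLebesgue choice n t m Y ∧
        ordinaryLebesgue (offered (malthusianFlow lam) ordinaryLebesgue choice t m Y (n - 1)) =
          ENNReal.ofReal (m (n - 1))) ∧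
      IsSPCDSolution (malthusianFlow lam) ordinaryLebesgue choice n t m
        (∑ k ∈ Finset.range n, m k * Real.exp (-(t k) * L))) ∧
    ((IsPressingFlow (malthusianFlow lam) ordinaryLebesgue ∨
        IsExpansibleFlow (malthusianFlow lam) ordinaryLebesgue ∨
        IsStableFlow (malthusianFlow lam) ordinaryLebesgue) →
      ∃ M : ℝ, IsSPCDSolution (malthusianFlow lam) ordinaryLebesgue choice n t m M) ∧
    ((IsTotallyPressingFlow (malthusianFlow lam) ordinaryLebesgue ∨
        IsTotallyExpansibleFlow (malthusianFlow lam) ordinaryLebesgue) →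
      0 < t 0 →
      ¬ ∃ M : ℝ, IsSPCDSolution (malthusianFlow lam) ordinaryLebesgue choice n t m M) := by
  have ht' : ∀ k < n, t 0 ≤ t k := fun k hk => by
    rcases k.eq_zero_or_pos with rfl | h
    exacts [le_rfl, (ht 0 k h hk).le]
  refine ⟨fun L hL => ⟨fun Y hY hμ => ?_, isSPCDSolution_of_tendsto hL hchoice hn hm⟩,
    fun h => ?_, fun h ht₀ ⟨M, hM⟩ => ?_⟩
  · have hsat := demandsSatisfied_of_ordinaryLebesgue_eq hL hchoice hm hY hμ
    obtain ⟨k, rfl⟩ := Nat.exists_eq_add_of_le' hn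
    exact ⟨hsat, ordinaryLebesgue_offered_last hL hm hY hμ hsat⟩
  · obtain ⟨L, hL⟩ := exists_tendsto_sum_of_monotone_flow h
    exact ⟨_, isSPCDSolution_of_tendsto hL hchoice hn hm⟩
  · rcases h with h | h
    · exact not_isSPCDSolution_of_totallyPressing h hn (hm 0 hn) ht₀ M hM
    · exact not_isSPCDSolution_of_totallyExpansible h hchoice hn ht' hm ht₀ M hM
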